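/- **Theorem 3.1.** A bidirected multigraph $B$ consists of a multigraph without loops (parallel edges are allowed), with vertex set $V(B)$ and edge set $E(B)$, together with a signing $\sigma$ that assigns a sign $\sigma(v,e)\in\{+,-\}$ to every pair of an edge $e$ and an endvertex $v$ of $e$. A path in $B$ is a path $v_0e_1v_1\dots e_\ell v_\ell$ in the underlying multigraph (so $v_0,\dots,v_\ell$ are distinct) such that $\sigma(v_i,e_i)\neq\sigma(v_i,e_{i+1})$ for all $1\le i\le \ell-1$. For $X\subseteq V(B)$, an $X$-path is such a path with $\ell\ge 1$, $v_0,v_\ell\in X$ and $v_1,\dots,v_{\ell-1}\notin X$. Paths are disjoint if they have no common vertex. Let $B$ be a bidirected multigraph with finite vertex set and signing $\sigma$, let $X\subseteq V(B)$, and let $k\ge 0$ be an integer. Then $B$ admits a set of $k$ pairwise disjoint $X$-paths if and only if for all $S,T\subseteq V(B)$ with $X\cap S=X\cap T$ we have $$|S\cap T|+\sum_{C}\left\lfloor \tfrac12\,|V(C)\cap(X\cup S\cup T)|\right\rfloor\ \ge\ k,$$ where $C$ runs over the components (maximal connected submultigraphs) of the undirected multigraph $B_{S,T}$ with vertex set $V(B)$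 whose edges are those $e\in E(B)$ such that each endvertex $v$ of $e$ satisfies $v\notin S\cup T$, or $v\in S\setminus T$ and $\sigma(v,e)=-$, or $v\in T\setminus S$ and $\sigma(v,e)=+$. -/

import Mathlib

open scoped Graph

/-- The two signs `-` and `+`. -/
inductive EdgeSign where
  | minus : EdgeSign
  | plus : EdgeSign

/-- A half-edge of a multigraph: a pair `(v, e)` such that `v` is an endvertex of the edge `e`. -/
def Graph.HalfEdge {α β : Type*} (G : Graph α β) : Type _ :=
  {p : α × β // G.Inc p.2 p.1}

/-- A multigraph is connected if it has a vertex and any two of its vertices are joined by a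
walk in it. -/
def Graph.IsConnected {α β : Type*} (G : Graph α β) : Prop :=
  V(G).Nonempty ∧ ∀ u ∈ V(G), ∀ v ∈ V(G), Relation.ReflTransGen G.Adj u v

/-- The components of a multigraph: its maximal connected submultigraphs. -/
def Graph.components {α β : Type*} (G : Graph α β) : Set (Graph α β) :=
  {C | Maximal (fun H : Graph α β => H ≤ G ∧ H.IsConnected) C}

/-- A bidirected multigraph: a loopless multigraph together with a sign for each half-edge. -/
structure BidirectedMultigraph (α β : Type*) where
  /-- the underlying multigraph -/
  graph : Graph α β
  loopless : graph.Loopless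
  signing : graph.HalfEdge → EdgeSign

namespace BidirectedMultigraph

/-- The sign of the edge `e` at its endvertex `v`. -/
def sign {α β : Type*} (B : BidirectedMultigraph α β) (v : α) (e : β) (h : B.graph.Inc e v) :
    EdgeSign :=
  B.signing ⟨(v, e), h⟩

/-- A path `v₀ e₁ v₁ … e_ℓ v_ℓ` in a bidirected multigraph: a path in the underlying multigraph
(so its vertices are distinct) whose two half-edges at each internal vertex have distinct signs.
The edge from `vertex i` to `vertex (i + 1)` is `edge i`. -/
structure Path {α β : Type*} (B : BidirectedMultigraph α β) where
  /-- the number `ℓ` of edges -/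
  length : ℕ
  vertex : Fin (length + 1) → α
  edge : Fin length → β
  vertex_mem : ∀ i, vertex i ∈ V(B.graph)
  vertex_injective : Function.Injective vertex
  isLink : ∀ i : Fin length, B.graph.IsLink (edge i) (vertex i.castSucc) (vertex i.succ)
  sign_ne : ∀ (i j : Fin length) (v : α), vertex i.succ = v → vertex j.castSucc = v →
    ∀ (hi : B.graph.Inc (edge i) v) (hj : B.graph.Inc (edge j) v),
      B.sign v (edge i) hi ≠ B.sign v (edge j) hj

/-- The set of vertices of a path. -/
def Path.vertexSet {α β : Type*} {B : BidirectedMultigraph α β} (P : B.Path) : Set α :=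
  Set.range P.vertex

/-- An `X`-path is a non-trivial path whose two endvertices lie in `X` and which has no other
vertex in `X`. -/
def Path.IsXPath {α β : Type*} {B : BidirectedMultigraph α β} (P : B.Path) (X : Set α) : Prop :=
  P.length ≠ 0 ∧ P.vertex 0 ∈ X ∧ P.vertex (Fin.last P.length) ∈ X ∧
    ∀ i, i ≠ 0 → i ≠ Fin.last P.length → P.vertex i ∉ X

/-- `B` admits a set of `k` pairwise (vertex-)disjoint `X`-paths. -/
def HasDisjointXPaths {α β : Type*} (B : BidirectedMultigraph α β) (X : Set α) (k : ℕ) : Prop :=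
  ∃ F : Finset B.Path, F.card = k ∧ (∀ P ∈ F, P.IsXPath X) ∧
    ∀ P ∈ F, ∀ Q ∈ F, P ≠ Q → Disjoint P.vertexSet Q.vertexSet

/-- The undirected multigraph `B_{S,T}`: it has all vertices of `B`, and those edges `e` of `B`
each of whose endvertices `v` lies outside `S ∪ T`, or lies in `S \ T` and `e` has sign `-` at `v`,
or lies in `T \ S` and `e` has sign `+` at `v`. -/
def separated {α β : Type*} (B : BidirectedMultigraph α β) (S T : Set α) : Graph α β :=
  B.graph.restrict {e | ∀ (v : α) (h : B.graph.Inc e v),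
    v ∉ S ∪ T ∨ (v ∈ S \ T ∧ B.sign v e h = EdgeSign.minus) ∨
      (v ∈ T \ S ∧ B.sign v e h = EdgeSign.plus)}

end BidirectedMultigraph

/-!
The min-max theorem is the Tutte–Berge theorem for an auxiliary graph. Replace every vertex
`v ∉ X` by two adjacent copies, one for each sign, keep every `x ∈ X` as a single vertex, and attach
each edge of `B` to the copies prescribed by its signs (`splitGraph`). Let `M₀` be the matching
formed by the edges between the two copies of each `v ∉ X`; it misses exactly `X`. A path of `B`
passes through an internal vertex `v ∉ X` by entering one copy and leaving from the other, so the
`X`-paths of `B` are the `M₀`-augmenting paths of the split graph, and `k` disjoint `X`-paths exist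
if and only if the split graph has a matching missing at most `|X| - 2k` vertices.

Sufficiency of the inequality. A set `U` of vertices of the split graph corresponds to the pair
`(S, T)` in which `S` (respectively `T`) consists of the vertices whose positive (respectively
negative) copy lies in `U`. Then `X ∩ S = X ∩ T`, and `B_{S,T}` has the same components as the split
graph without `U`, except that it also has the vertices of `S ∩ T` as singletons
(`splitGraph_reachable_iff`). Outside these singletons, the size of a component of the split graph
has the parity of `|V(C) ∩ (X ∪ S ∪ T)|`, and `|U| + |X| = |X ∪ S ∪ T| + |S ∩ T|`, so the inequality
for `(S, T)` becomes Berge's bound on the number of odd components (`splitGraph_oddComponents_le`).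
Berge's condition is reduced to Tutte's theorem by adding `|X| - 2k` universal vertices
(`SimpleGraph.exists_involutive_of_oddComponents_le`). The resulting perfect matching is an
involution `f`, the matching `M₀` an involution `g` with the vertices of `X` and the added vertices
as fixed points, and the alternating paths are orbits of `g ∘ f` running between fixed points of `g`
(`IsAltPath`). At most `|X| - 2k` of the vertices of `X` are joined in this way to an added vertex;
the others are paired up by disjoint `X`-paths (`exists_splitWalks`).

Necessity. An `X`-path avoiding `S ∩ T` has two vertices of `X ∪ S ∪ T` in one component of
`B_{S,T}` (`BidirectedMultigraph.Path.IsXPath.exists_pair`), so disjoint paths are counted by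
`|S ∩ T| + ∑ ⌊|V(C) ∩ (X ∪ S ∪ T)| / 2⌋` (`SimpleGraph.card_le_ncard_add_finsum`).
-/

open scoped Graph

/-! ### Odd components and the Tutte–Berge theorem -/

namespace SimpleGraph

/-- A map between the vertex sets of two graphs preserves and reflects reachability if it sends
edges into components, its fibres lie inside components, and edges at an image vertex lift. -/
lemma reachable_iff_of_lift {Z V : Type*} {K : SimpleGraph Z} {H : SimpleGraph V} (π : Z → V)
    (h_adj : ∀ a b, K.Adj a b → H.Reachable (π a) (π b))
    (h_fib : ∀ a b, π a = π b → K.Reachable a b)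
    (h_lift : ∀ a v, H.Adj (π a) v → ∃ b, π b = v ∧ K.Reachable a b) (a b : Z) :
    K.Reachable a b ↔ H.Reachable (π a) (π b) := by
  constructor
  · rintro ⟨p⟩
    induction p with
    | nil => exact Reachable.rfl
    | cons h _ ih => exact (h_adj _ _ h).trans ih
  · intro h
    have key : ∀ v, Relation.ReflTransGen H.Adj (π a) v → ∃ b, π b = v ∧ K.Reachable a b := by
      intro v hv
      induction hv with
      | refl => exact ⟨a, rfl, Reachable.rfl⟩
      | tail _ h ih =>
        obtain ⟨b, rfl, hb⟩ := ih
        obtain ⟨c, hc, hbc⟩ := h_lift _ _ h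
        exact ⟨c, hc, hb.trans hbc⟩
    obtain ⟨c, hc, hac⟩ := key _ (H.reachable_iff_reflTransGen _ _ |>.1 h)
    exact hac.trans (h_fib _ _ hc)

/-- If `π` preserves and reflects reachability, the odd components upstairs inject into the
components downstairs with an odd number of preimages. -/
lemma ncard_oddComponents_le_of_reachable_iff {Z V : Type*} [Finite V] {K : SimpleGraph Z}
    {H : SimpleGraph V} (π : Z → V)
    (h : ∀ a b, K.Reachable a b ↔ H.Reachable (π a) (π b)) :
    K.oddComponents.ncard ≤
      {c : H.ConnectedComponent | Odd (π ⁻¹' c.supp).ncard}.ncard := by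
  let F : K.ConnectedComponent → H.ConnectedComponent :=
    Quot.lift (fun z => H.connectedComponentMk (π z))
      (fun a b hab => ConnectedComponent.sound ((h a b).1 hab))
  have hF : ∀ z, F (K.connectedComponentMk z) = H.connectedComponentMk (π z) := fun _ => rfl
  refine Set.ncard_le_ncard_of_injOn F ?_ ?_ (Set.toFinite _)
  · intro c hc
    induction c using ConnectedComponent.ind with | h z
    have : (K.connectedComponentMk z).supp = π ⁻¹' (F (K.connectedComponentMk z)).supp := by
      ext a
      simp [hF, ConnectedComponent.mem_supp_iff, ConnectedComponent.eq, h]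
    change Odd (π ⁻¹' (F (K.connectedComponentMk z)).supp).ncard
    rw [← this]
    exact hc
  · intro c _ c' _ hcc
    induction c using ConnectedComponent.ind with | h z
    induction c' using ConnectedComponent.ind with | h z'
    rw [hF, hF, ConnectedComponent.eq] at hcc
    exact ConnectedComponent.sound ((h z z').2 hcc)

/-- The graph obtained from `G` by adding `d` vertices, each adjacent to every other vertex. -/
def addUniversal {W : Type*} (G : SimpleGraph W) (d : ℕ) : SimpleGraph (W ⊕ Fin d) where
  Adj x y := x ≠ y ∧ ∀ a b, x = Sum.inl a → y = Sum.inl b → G.Adj a b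
  symm := ⟨fun _ _ h => ⟨h.1.symm, fun a b ha hb => (h.2 b a hb ha).symm⟩⟩
  loopless := ⟨fun _ h => h.1 rfl⟩

/-- The **Tutte–Berge theorem** in deficiency form. If no vertex set `u` leaves more than `|u| + d`
odd components, then `G` together with `d` universal vertices has a perfect matching, given
here as a fixed-point-free involution. -/
theorem exists_involutive_of_oddComponents_le {W : Type*} [Finite W] (G : SimpleGraph W) (d : ℕ)
    (hpar : Even (Nat.card W + d))
    (h : ∀ u : Set W, (G.induce uᶜ).oddComponents.ncard ≤ u.ncard + d) :
    ∃ f : W ⊕ Fin d → W ⊕ Fin d, Function.Involutive f ∧ (∀ x, f x ≠ x) ∧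
      ∀ a b, f (Sum.inl a) = Sum.inl b → G.Adj a b := by
  have htutte : ∃ M : (G.addUniversal d).Subgraph, M.IsPerfectMatching := by
    rw [tutte]
    intro u hu
    rw [IsTutteViolator] at hu
    -- If `u` contains all added vertices, the rest of `u` violates the hypothesis on `G`. Otherwise
    -- the graph without `u` is connected, so `u` is empty, which contradicts parity.
    by_cases hD : ∀ i : Fin d, Sum.inr i ∈ u
    · have hu' : u.ncard = (Sum.inl ⁻¹' u : Set W).ncard + d := by
        have : u = Sum.inl '' (Sum.inl ⁻¹' u : Set W) ∪ Set.range Sum.inr := by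
          ext (a | i) <;> simp [hD]
        rw [this, Set.ncard_union_eq]
        · rw [Set.ncard_image_of_injective _ Sum.inl_injective, ← Set.image_univ,
            Set.ncard_image_of_injective _ Sum.inr_injective]
          simp [Set.preimage_image_eq _ Sum.inl_injective]
        · rw [Set.disjoint_left]
          rintro _ ⟨a, _, rfl⟩ ⟨i, hi⟩
          cases hi
      let π : ↥((⊤ : (G.addUniversal d).Subgraph).deleteVerts u).verts →
          ↥(Sum.inl ⁻¹' u : Set W)ᶜ := fun z => match z with
        | ⟨Sum.inl a, ha⟩ => ⟨a, ha.2⟩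
        | ⟨Sum.inr i, hi⟩ => absurd (hD i) hi.2
      have hπ : ∀ z, Sum.inl (π z).1 = z.1 := by
        rintro ⟨a | i, hz⟩
        · rfl
        · exact absurd (hD i) hz.2
      have hinj : Function.Injective π := by
        intro z z' hzz
        apply Subtype.ext
        rw [← hπ, ← hπ, hzz]
      have hsurj : Function.Surjective π := by
        rintro ⟨a, ha⟩
        exact ⟨⟨Sum.inl a, ⟨trivial, ha⟩⟩, rfl⟩
      have hadj : ∀ a b, (((⊤ : (G.addUniversal d).Subgraph).deleteVerts u).coe).Adj a b ↔
          (G.induce (Sum.inl ⁻¹' u : Set W)ᶜ).Adj (π a) (π b) := by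
        intro a b
        have ha := a.2.2
        have hb := b.2.2
        have e : (G.addUniversal d).Adj a.1 b.1 ↔ G.Adj (π a).1 (π b).1 := by
          rw [← hπ a, ← hπ b]
          constructor
          · exact fun h => h.2 _ _ rfl rfl
          · intro h
            refine ⟨fun h' => h.ne (Sum.inl_injective h'), fun _ _ h1 h2 => ?_⟩
            rwa [← Sum.inl_injective h1, ← Sum.inl_injective h2]
        simp [ha, hb, e]
      have hle := ncard_oddComponents_le_of_reachable_iff π (reachable_iff_of_lift π
        (fun a b hab => ((hadj a b).1 hab).reachable)
        (fun a b hab => by rw [hinj hab])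
        (fun a v hav => by
          obtain ⟨b, rfl⟩ := hsurj v
          exact ⟨b, rfl, ((hadj a b).2 hav).reachable⟩))
      have heq : {c : (G.induce (Sum.inl ⁻¹' u : Set W)ᶜ).ConnectedComponent |
          Odd (π ⁻¹' c.supp).ncard} = (G.induce (Sum.inl ⁻¹' u : Set W)ᶜ).oddComponents := by
        ext c
        have : (π ⁻¹' c.supp).ncard = c.supp.ncard :=
          Set.ncard_preimage_of_injective_subset_range hinj (by simp [hsurj.range_eq])
        simp [this]
      rw [heq] at hle
      have := h (Sum.inl ⁻¹' u)
      omega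
    · push Not at hD
      obtain ⟨i, hi⟩ := hD
      set K := ((⊤ : (G.addUniversal d).Subgraph).deleteVerts u).coe with hK
      let z : ↥((⊤ : (G.addUniversal d).Subgraph).deleteVerts u).verts := ⟨Sum.inr i, ⟨trivial, hi⟩⟩
      have hconn : ∀ a, K.Reachable z a := by
        intro a
        by_cases haz : z = a
        · rw [haz]
        · refine Adj.reachable ?_
          have ha := a.2.2
          have hne : Sum.inr i ≠ a.1 := fun h => haz (Subtype.ext h)
          have : (G.addUniversal d).Adj (Sum.inr i) a.1 := ⟨hne, fun _ _ h => by cases h⟩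
          simp [hK, z, ha, hi, this]
      have hsub : K.oddComponents.ncard ≤ 1 := by
        rw [Set.ncard_le_one]
        intro a _ b _
        induction a using ConnectedComponent.ind with | h a
        induction b using ConnectedComponent.ind with | h b
        exact ConnectedComponent.sound ((hconn a).symm.trans (hconn b))
      have h1 : K.oddComponents.ncard = 1 := by omega
      have h0 : u.ncard = 0 := by omega
      rw [Set.ncard_eq_zero] at h0
      have hodd := (K.odd_ncard_oddComponents).1 (by rw [h1]; exact odd_one)
      rw [Nat.card_coe_set_eq] at hodd
      rw [Subgraph.deleteVerts_verts, h0, Set.sdiff_empty, Subgraph.verts_top, Set.ncard_univ,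
        Nat.card_sum, Nat.card_fin] at hodd
      exact (Nat.not_even_iff_odd.2 hodd) hpar
  obtain ⟨M, hM⟩ := htutte
  rw [Subgraph.isPerfectMatching_iff] at hM
  choose f hf huniq using hM
  refine ⟨f, fun x => (huniq _ _ (hf x).symm).symm, fun x hx => ?_, fun a b hab => ?_⟩
  · have := hf x
    rw [hx] at this
    exact this.ne rfl
  · have := hf (Sum.inl a)
    rw [hab] at this
    exact this.adj_sub.2 _ _ rfl rfl

end SimpleGraph

/-! ### Alternating paths of two involutions -/

section Alternating

variable {Ω : Type*} {f g : Ω → Ω}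

/-- Starting at `g p_i` and applying `g ∘ f`, the orbit `p` of `x` is run through backwards. -/
lemma iterate_comp_apply_reverse (hf : f.Involutive) (hg : g.Involutive) (x : Ω) {j i : ℕ}
    (hji : j ≤ i) : (g ∘ f)^[j] (g ((g ∘ f)^[i] x)) = g ((g ∘ f)^[i - j] x) := by
  induction j with
  | zero => rfl
  | succ j ih =>
    rw [Function.iterate_succ_apply', ih (by omega)]
    obtain ⟨m, hm⟩ : ∃ m, i - j = m + 1 := ⟨i - j - 1, by omega⟩
    have hm' : i - (j + 1) = m := by omega
    rw [hm, hm', Function.iterate_succ_apply']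
    simp [hg _, hf _]

/-- `IsAltPath f g x L` says that `L` is the first positive time at which the orbit of `x` under
`g ∘ f` meets the fixed points of `g`: the alternating path starting at `x` has `L` steps. -/
def IsAltPath (f g : Ω → Ω) (x : Ω) (L : ℕ) : Prop :=
  0 < L ∧ g ((g ∘ f)^[L] x) = (g ∘ f)^[L] x ∧
    ∀ i, 0 < i → i < L → g ((g ∘ f)^[i] x) ≠ (g ∘ f)^[i] x

lemma exists_isAltPath [Finite Ω] (hf : f.Involutive) (hg : g.Involutive) {x : Ω}
    (hx : g x = x) : ∃ L, IsAltPath f g x L := by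
  classical
  have hinj : Function.Injective (g ∘ f) := hg.injective.comp hf.injective
  obtain ⟨n, hn, hp⟩ := Function.Injective.mem_periodicPts hinj x
  have hex : ∃ n, 0 < n ∧ g ((g ∘ f)^[n] x) = (g ∘ f)^[n] x := by
    refine ⟨n, hn, ?_⟩
    rw [show (g ∘ f)^[n] x = x from hp, hx]
  refine ⟨Nat.find hex, (Nat.find_spec hex).1, (Nat.find_spec hex).2, fun i hi hil h => ?_⟩
  exact Nat.find_min hex hil ⟨hi, h⟩

namespace IsAltPath

variable {x y : Ω} {L L' : ℕ}

lemma unique (h : IsAltPath f g x L) (h' : IsAltPath f g x L') : L = L' := by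
  rcases lt_trichotomy L L' with hl | hl | hl
  · exact absurd h.2.1 (h'.2.2 _ h.1 hl)
  · exact hl
  · exact absurd h'.2.1 (h.2.2 _ h'.1 hl)

/-- A fixed point of `g` on the alternating path is one of its two ends. -/
lemma eq_zero_or_eq (h : IsAltPath f g x L) {i : ℕ} (hi : i ≤ L)
    (hfix : g ((g ∘ f)^[i] x) = (g ∘ f)^[i] x) : i = 0 ∨ i = L := by
  by_contra! hne
  exact h.2.2 i (by omega) (by omega) hfix

/-- The path does not revisit a pair `{a, g a}`: folding such a coincidence inwards would give
a fixed point of `f`, or an early fixed point of `g`. -/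
lemma ne_apply (hf : f.Involutive) (hg : g.Involutive) (hff : ∀ a, f a ≠ a)
    (h : IsAltPath f g x L) {i j : ℕ} (hij : i < j) (hj : j ≤ L) :
    (g ∘ f)^[i] x ≠ g ((g ∘ f)^[j] x) := by
  intro he
  induction hn : j - i using Nat.strong_induction_on generalizing i j with
  | _ n ih =>
    rcases Nat.lt_or_ge (i + 1) j with h1 | h1
    · have he' : (g ∘ f)^[i + 1] x = g ((g ∘ f)^[j - 1] x) := by
        rw [Function.iterate_succ_apply', he]
        exact iterate_comp_apply_reverse hf hg x (j := 1) (by omega)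
      rcases Nat.lt_or_ge (i + 1) (j - 1) with h2 | h2
      · exact ih (j - 1 - (i + 1)) (by omega) h2 (by omega) he' rfl
      · have : j - 1 = i + 1 := by omega
        rw [this] at he'
        exact h.2.2 (i + 1) (by omega) (by omega) he'.symm
    · have : j = i + 1 := by omega
      subst this
      rw [Function.iterate_succ_apply', Function.comp_apply, hg] at he
      exact hff _ he.symm

lemma iterate_ne (hf : f.Involutive) (hg : g.Involutive) (hff : ∀ a, f a ≠ a) (hx : g x = x)
    (h : IsAltPath f g x L) {i j : ℕ} (hij : i < j) (hj : j ≤ L) :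
    (g ∘ f)^[i] x ≠ (g ∘ f)^[j] x := by
  intro he
  have hinj : Function.Injective (g ∘ f) := hg.injective.comp hf.injective
  have hx' : x = (g ∘ f)^[j - i] x := by
    apply hinj.iterate i
    rw [← Function.iterate_add_apply, he]
    congr 1
    omega
  have := h.eq_zero_or_eq (i := j - i) (by omega) (by rw [← hx', hx])
  have hL : j - i = L := by omega
  refine h.ne_apply hf hg hff h.1 le_rfl ?_
  rw [h.2.1, ← hL]
  exact hx'

/-- The alternating path starting at the other end is the reversed path. -/
lemma reverse (hf : f.Involutive) (hg : g.Involutive) (hx : g x = x) (h : IsAltPath f g x L) :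
    IsAltPath f g ((g ∘ f)^[L] x) L ∧
      ∀ i ≤ L, (g ∘ f)^[i] ((g ∘ f)^[L] x) = g ((g ∘ f)^[L - i] x) := by
  have key : ∀ i ≤ L, (g ∘ f)^[i] ((g ∘ f)^[L] x) = g ((g ∘ f)^[L - i] x) := by
    intro i hi
    rw [← iterate_comp_apply_reverse hf hg x hi, h.2.1]
  refine ⟨⟨h.1, ?_, fun i hi hiL hfix => ?_⟩, key⟩
  · rw [key L le_rfl, Nat.sub_self, Function.iterate_zero_apply, hx, hx]
  · rw [key i hiL.le, hg] at hfix
    exact h.2.2 (L - i) (by omega) (by omega) hfix.symm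

lemma eq_or_eq_of_iterate_eq (hf : f.Involutive) (hg : g.Involutive) (hx : g x = x)
    (hy : g y = y) (h : IsAltPath f g x L) (h' : IsAltPath f g y L') {i j : ℕ} (hi : i ≤ L)
    (hj : j ≤ L') (he : (g ∘ f)^[i] x = (g ∘ f)^[j] y) : x = y ∨ y = (g ∘ f)^[L] x := by
  have hinj : Function.Injective (g ∘ f) := hg.injective.comp hf.injective
  rcases Nat.le_total i j with hij | hij
  · have hx' : x = (g ∘ f)^[j - i] y := by
      apply hinj.iterate i
      rw [← Function.iterate_add_apply, he]
      congr 1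
      omega
    rcases h'.eq_zero_or_eq (i := j - i) (by omega) (by rw [← hx', hx]) with h0 | h0
    · left
      rwa [h0] at hx'
    · right
      rw [h0] at hx'
      obtain ⟨hr, hrev⟩ := h'.reverse hf hg hy
      rw [← hx'] at hr
      rw [h.unique hr]
      rw [hx', hrev L' le_rfl, Nat.sub_self, Function.iterate_zero_apply, hy]
  · have hy' : y = (g ∘ f)^[i - j] x := by
      apply hinj.iterate j
      rw [← Function.iterate_add_apply, ← he]
      congr 1
      omega
    rcases h.eq_zero_or_eq (i := i - j) (by omega) (by rw [← hy', hy]) with h0 | h0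
    · left
      rw [h0] at hy'
      exact hy'.symm
    · right
      rwa [h0] at hy'

/-- Two alternating paths meeting in a pair `{a, g a}` are equal or reverses of each other. -/
lemma eq_or_eq_of_meet (hf : f.Involutive) (hg : g.Involutive) (hx : g x = x)
    (hy : g y = y) (h : IsAltPath f g x L) (h' : IsAltPath f g y L') {i j : ℕ} (hi : i ≤ L)
    (hj : j ≤ L')
    (he : (g ∘ f)^[i] x = (g ∘ f)^[j] y ∨ (g ∘ f)^[i] x = g ((g ∘ f)^[j] y)) :
    x = y ∨ y = (g ∘ f)^[L] x := by
  rcases he with he | he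
  · exact eq_or_eq_of_iterate_eq hf hg hx hy h h' hi hj he
  · obtain ⟨hr, hrev⟩ := h'.reverse hf hg hy
    have he' : (g ∘ f)^[i] x = (g ∘ f)^[L' - j] ((g ∘ f)^[L'] y) := by
      rw [hrev _ (by omega), he]
      congr 2
      omega
    have hyy : y = (g ∘ f)^[L'] ((g ∘ f)^[L'] y) := by
      rw [hrev L' le_rfl, Nat.sub_self, Function.iterate_zero_apply, hy]
    -- The point `g p_j` on the path from `y` is a point of the reversed path.
    rcases eq_or_eq_of_iterate_eq hf hg hx h'.2.1 h hr hi (by omega) he' with h1 | h1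
    · right
      rw [← h1] at hr hyy
      rwa [h.unique hr]
    · left
      obtain ⟨hr2, hrev2⟩ := h.reverse hf hg hx
      rw [← h1] at hr2
      have := hr2.unique hr
      subst this
      rw [hyy, h1, hrev2 _ le_rfl, Nat.sub_self, Function.iterate_zero_apply, hx]

end IsAltPath

end Alternating

/-- A fixed-point-free involution of a finite set has a transversal. -/
lemma exists_transversal_of_involution {Ω : Type*} (A : Finset Ω) (e : Ω → Ω)
    (hA : ∀ a ∈ A, e a ∈ A) (hee : ∀ a ∈ A, e (e a) = a) (hne : ∀ a ∈ A, e a ≠ a) :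
    ∃ I ⊆ A, A.card ≤ 2 * I.card ∧ ∀ a ∈ I, ∀ b ∈ I, e a ≠ b := by
  classical
  obtain ⟨r, hr⟩ : ∃ r : Ω → ℕ, Set.InjOn r A :=
    Set.countable_iff_exists_injOn.1 A.finite_toSet.countable
  have hI : A ⊆ A.filter (fun a => r a < r (e a)) ∪
      (A.filter (fun a => r a < r (e a))).image e := by
    intro a ha
    rcases lt_trichotomy (r a) (r (e a)) with h | h | h
    · exact Finset.mem_union_left _ (Finset.mem_filter.2 ⟨ha, h⟩)
    · exact absurd (hr ha (hA a ha) h).symm (hne a ha)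
    · refine Finset.mem_union_right _ (Finset.mem_image.2 ⟨e a, Finset.mem_filter.2 ⟨hA a ha, ?_⟩,
        hee a ha⟩)
      rwa [hee a ha]
  refine ⟨A.filter (fun a => r a < r (e a)), Finset.filter_subset _ _, ?_, ?_⟩
  · have h1 := Finset.card_le_card hI
    have h2 := Finset.card_union_le (A.filter (fun a => r a < r (e a)))
      ((A.filter (fun a => r a < r (e a))).image e)
    have h3 : ((A.filter (fun a => r a < r (e a))).image e).card ≤ _ := Finset.card_image_le
    omega
  · rintro a ha _ hb rfl
    rw [Finset.mem_filter] at ha hb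
    rw [hee a ha.1] at hb
    omega

/-! ### The split graph -/

section Split

variable {V : Type*} {X : Set V}

/-- The vertex of the original graph underlying a vertex of the split graph. The split graph has
vertex set `V ⊕ ↥Xᶜ`: a vertex `v ∉ X` is split into `inl v` for the sign `+` and `inr v` for the
sign `-`, while a vertex of `X` is kept as the single vertex `inl v`. -/
def splitProj (X : Set V) : V ⊕ ↥Xᶜ → V := Sum.elim id Subtype.val

open Classical in
/-- The vertex of the split graph to which half-edges of sign `p.2` at the vertex `p.1` are
attached. -/
noncomputable def splitPort (X : Set V) (p : V × EdgeSign) : V ⊕ ↥Xᶜ :=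
  match p with
  | (v, EdgeSign.plus) => Sum.inl v
  | (v, EdgeSign.minus) => if h : v ∈ X then Sum.inl v else Sum.inr ⟨v, h⟩

/-- The involution exchanging the two copies of each vertex outside `X`. -/
noncomputable def splitMate (X : Set V) : V ⊕ ↥Xᶜ → V ⊕ ↥Xᶜ
  | Sum.inl v => splitPort X (v, EdgeSign.minus)
  | Sum.inr v => Sum.inl v

@[simp] lemma splitProj_inl (v : V) : splitProj X (Sum.inl v) = v := rfl

@[simp] lemma splitProj_inr (v : ↥Xᶜ) : splitProj X (Sum.inr v) = v := rfl

@[simp] lemma splitPort_plus (v : V) : splitPort X (v, EdgeSign.plus) = Sum.inl v := rfl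

lemma splitPort_minus_of_mem {v : V} (h : v ∈ X) :
    splitPort X (v, EdgeSign.minus) = Sum.inl v := dif_pos h

lemma splitPort_minus_of_notMem {v : V} (h : v ∉ X) :
    splitPort X (v, EdgeSign.minus) = Sum.inr ⟨v, h⟩ := dif_neg h

@[simp] lemma splitProj_port (p : V × EdgeSign) : splitProj X (splitPort X p) = p.1 := by
  obtain ⟨v, _ | _⟩ := p
  · by_cases h : v ∈ X
    · simp [splitPort_minus_of_mem h]
    · simp [splitPort_minus_of_notMem h]
  · rfl

lemma splitMate_involutive : Function.Involutive (splitMate X) := by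
  rintro (v | v)
  · by_cases h : v ∈ X
    · simp [splitMate, splitPort_minus_of_mem h]
    · simp [splitMate, splitPort_minus_of_notMem h]
  · simpa [splitMate] using splitPort_minus_of_notMem v.2

@[simp] lemma splitProj_mate (w : V ⊕ ↥Xᶜ) : splitProj X (splitMate X w) = splitProj X w := by
  rcases w with v | v <;> simp [splitMate]

lemma splitMate_eq_self_iff (w : V ⊕ ↥Xᶜ) : splitMate X w = w ↔ splitProj X w ∈ X := by
  rcases w with v | v
  · by_cases h : v ∈ X
    · simp [splitMate, splitPort_minus_of_mem h, h]
    · simp [splitMate, splitPort_minus_of_notMem h, h]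
  · simp [splitMate, show (v : V) ∉ X from v.2]

lemma eq_or_eq_splitMate {w w' : V ⊕ ↥Xᶜ} (h : splitProj X w = splitProj X w') :
    w = w' ∨ w = splitMate X w' := by
  rcases w with v | v <;> rcases w' with v' | v'
  · left; simpa using h
  · right; simpa [splitMate] using h
  · right
    obtain rfl : (v : V) = v' := h
    exact (splitPort_minus_of_notMem v.2).symm
  · left; simpa [Subtype.ext_iff] using h

/-- An edge arriving at the mate of the copy from which another edge leaves has the opposite
sign. -/
lemma sign_ne_of_splitPort_eq_mate {v : V} (hv : v ∉ X) {s t : EdgeSign}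
    (h : splitPort X (v, s) = splitMate X (splitPort X (v, t))) : s ≠ t := by
  rintro rfl
  refine hv ?_
  have := (splitMate_eq_self_iff _).1 h.symm
  simpa using this

/-- The split graph of a symmetric relation `R` between signed vertices: the two copies of each
vertex outside `X` are joined, and so are the copies carrying related signed vertices. -/
def splitGraph (X : Set V) (R : V × EdgeSign → V × EdgeSign → Prop)
    (hR : ∀ p q, R p q → R q p) : SimpleGraph (V ⊕ ↥Xᶜ) where
  Adj w w' := w ≠ w' ∧ (splitProj X w = splitProj X w' ∨
    ∃ p q, R p q ∧ splitPort X p = w ∧ splitPort X q = w')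
  symm := ⟨fun _ _ h => ⟨h.1.symm, h.2.imp Eq.symm
    (fun ⟨p, q, hpq, hp, hq⟩ => ⟨q, p, hR _ _ hpq, hq, hp⟩)⟩⟩
  loopless := ⟨fun _ h => h.1 rfl⟩

/-- The signed vertices surviving in `B_{S,T}`. -/
def SurvivesSeparation (S T : Set V) (p : V × EdgeSign) : Prop :=
  p.1 ∉ S ∪ T ∨ (p.1 ∈ S \ T ∧ p.2 = EdgeSign.minus) ∨ (p.1 ∈ T \ S ∧ p.2 = EdgeSign.plus)

/-- The simple graph underlying `B_{S,T}`, where `R` relates the two signed ends of each edge. -/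
def separatedGraph (R : V × EdgeSign → V × EdgeSign → Prop)
    (hR : ∀ p q, R p q → R q p) (S T : Set V) : SimpleGraph V where
  Adj u v := u ≠ v ∧ ∃ s t, R (u, s) (v, t) ∧ SurvivesSeparation S T (u, s) ∧
    SurvivesSeparation S T (v, t)
  symm := ⟨fun _ _ h => ⟨h.1.symm, by
    obtain ⟨-, s, t, h1, h2, h3⟩ := h
    exact ⟨t, s, hR _ _ h1, h3, h2⟩⟩⟩
  loopless := ⟨fun _ h => h.1 rfl⟩

lemma ncard_eq_sum_ite [Fintype V] (A : Set V) [DecidablePred (· ∈ A)] :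
    A.ncard = ∑ v, if v ∈ A then 1 else 0 := by
  rw [Set.ncard_eq_toFinset_card', ← Finset.card_filter]
  congr 1
  ext
  simp

lemma ncard_splitVertices [Finite V] (Q : Set (V ⊕ ↥Xᶜ)) :
    Q.ncard = (Sum.inl ⁻¹' Q).ncard + {v | v ∉ X ∧ splitPort X (v, EdgeSign.minus) ∈ Q}.ncard := by
  have h1 : Q = Sum.inl '' (Sum.inl ⁻¹' Q) ∪ Sum.inr '' (Sum.inr ⁻¹' Q) := by
    ext (a | a) <;> simp
  have h2 : {v | v ∉ X ∧ splitPort X (v, EdgeSign.minus) ∈ Q} =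
      Subtype.val '' (Sum.inr ⁻¹' Q : Set ↥Xᶜ) := by
    ext v
    constructor
    · rintro ⟨hv, hQ⟩
      rw [splitPort_minus_of_notMem hv] at hQ
      exact ⟨⟨v, hv⟩, hQ, rfl⟩
    · rintro ⟨v, hQ, rfl⟩
      refine ⟨v.2, ?_⟩
      rwa [splitPort_minus_of_notMem v.2]
  conv_lhs => rw [h1]
  rw [h2, Set.ncard_union_eq, Set.ncard_image_of_injective _ Sum.inl_injective,
    Set.ncard_image_of_injective _ Sum.inr_injective,
    Set.ncard_image_of_injective _ Subtype.val_injective]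
  rw [Set.disjoint_left]
  rintro _ ⟨a, _, rfl⟩ ⟨b, _, h⟩
  cases h

/-- The components of a finite graph partition every vertex set. -/
lemma SimpleGraph.finsum_ncard_supp_inter [Finite V] (H : SimpleGraph V) (A : Set V) :
    ∑ᶠ c : H.ConnectedComponent, (c.supp ∩ A).ncard = A.ncard := by
  classical
  have := Fintype.ofFinite V
  have := Fintype.ofFinite H.ConnectedComponent
  rw [finsum_eq_sum_of_fintype]
  simp_rw [ncard_eq_sum_ite]
  rw [Finset.sum_comm]
  refine Finset.sum_congr rfl fun v _ => ?_
  by_cases hv : v ∈ A <;> simp [hv, SimpleGraph.ConnectedComponent.mem_supp_iff]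

variable {R : V × EdgeSign → V × EdgeSign → Prop} {hR : ∀ p q, R p q → R q p}

/-- Deleting `U` from the split graph amounts to passing to `B_{S,T}`, where `S` and `T` consist of
the vertices whose positive and negative copy, respectively, lies in `U`. -/
lemma splitGraph_reachable_iff (U : Set (V ⊕ ↥Xᶜ)) (a b : ↥Uᶜ) :
    ((splitGraph X R hR).induce Uᶜ).Reachable a b ↔
      (separatedGraph R hR {v | splitPort X (v, EdgeSign.plus) ∈ U}
        {v | splitPort X (v, EdgeSign.minus) ∈ U}).Reachable
          (splitProj X a) (splitProj X b) := by
  set S := {v | splitPort X (v, EdgeSign.plus) ∈ U}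
  set T := {v | splitPort X (v, EdgeSign.minus) ∈ U}
  have h_surv : ∀ p, SurvivesSeparation S T p → splitPort X p ∉ U := by
    rintro ⟨v, _ | _⟩ hp h <;> simp_all [SurvivesSeparation, S, T]
  have h_surv' : ∀ p, splitPort X p ∉ U → SurvivesSeparation S T p := by
    rintro ⟨v, _ | _⟩ h <;> simp only [SurvivesSeparation, Set.mem_union, Set.mem_sdiff,
      Set.mem_ofPred_eq, S, T] <;> tauto
  have h_fib : ∀ a b : ↥Uᶜ, splitProj X a.1 = splitProj X b.1 →
      ((splitGraph X R hR).induce Uᶜ).Reachable a b := by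
    intro a b h
    by_cases hab : a = b
    · rw [hab]
    · refine SimpleGraph.Adj.reachable ?_
      exact ⟨fun h' => hab (Subtype.ext h'), Or.inl h⟩
  refine SimpleGraph.reachable_iff_of_lift (fun a : ↥Uᶜ => splitProj X a.1) ?_ h_fib ?_ a b
  · rintro ⟨a, ha⟩ ⟨b, hb⟩ ⟨hne, h⟩
    dsimp only at h ⊢
    by_cases hab : splitProj X a = splitProj X b
    · rw [hab]
    · rcases h with h | ⟨p, q, hpq, hp, hq⟩
      · exact absurd h hab
      · refine SimpleGraph.Adj.reachable ⟨hab, p.2, q.2, ?_⟩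
        change splitPort X p = a at hp
        change splitPort X q = b at hq
        subst hp hq
        simp only [splitProj_port]
        exact ⟨hpq, h_surv' p ha, h_surv' q hb⟩
  · rintro a v ⟨hne, s, t, hst, hs, ht⟩
    refine ⟨⟨splitPort X (v, t), h_surv _ ht⟩, splitProj_port _, ?_⟩
    refine (h_fib a ⟨splitPort X (splitProj X a.1, s), h_surv _ hs⟩ (by simp)).trans ?_
    refine SimpleGraph.Adj.reachable ⟨fun h => hne ?_, Or.inr ⟨_, _, hst, rfl, rfl⟩⟩
    simpa using congrArg (splitProj X) h

/-- A vertex of `S ∩ T` is isolated in `B_{S,T}`. -/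
lemma separatedGraph_supp_eq_singleton {S T : Set V} {v : V} (hS : v ∈ S) (hT : v ∈ T) :
    ((separatedGraph R hR S T).connectedComponentMk v).supp = {v} := by
  ext u
  rw [SimpleGraph.ConnectedComponent.mem_supp_iff, SimpleGraph.ConnectedComponent.eq,
    Set.mem_singleton_iff]
  constructor
  · intro h
    rcases ((SimpleGraph.reachable_iff_reflTransGen _ _).1 h.symm).cases_head with h | ⟨w, h, _⟩
    · exact h.symm
    · obtain ⟨-, s, t, -, h, -⟩ := h
      simp [SurvivesSeparation, hS, hT] at h
  · rintro rfl
    rfl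

/-- The min-max condition on all pairs `(S, T)` bounds the number of odd components left in the
split graph after deleting a vertex set. -/
lemma splitGraph_oddComponents_le [Finite V] {k : ℕ}
    (h : ∀ S T : Set V, X ∩ S = X ∩ T → k ≤ (S ∩ T).ncard +
      ∑ᶠ c : (separatedGraph R hR S T).ConnectedComponent, (c.supp ∩ (X ∪ S ∪ T)).ncard / 2)
    (U : Set (V ⊕ ↥Xᶜ)) :
    2 * k + ((splitGraph X R hR).induce Uᶜ).oddComponents.ncard ≤ U.ncard + X.ncard := by
  classical
  have := Fintype.ofFinite V
  set S := {v | splitPort X (v, EdgeSign.plus) ∈ U} with hS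
  set T := {v | splitPort X (v, EdgeSign.minus) ∈ U} with hT
  have hST : ∀ v ∈ X, (v ∈ S ↔ v ∈ T) := by
    intro v hv
    simp [hS, hT, splitPort_minus_of_mem hv]
  have hk := h S T (by ext v; have := hST v; simp only [Set.mem_inter_iff]; tauto)
  set H := separatedGraph R hR S T
  have := Fintype.ofFinite H.ConnectedComponent
  let π : ↥Uᶜ → V := fun a => splitProj X a.1
  have hodd : ((splitGraph X R hR).induce Uᶜ).oddComponents.ncard ≤
      {c : H.ConnectedComponent | Odd (π ⁻¹' c.supp).ncard}.ncard :=
    SimpleGraph.ncard_oddComponents_le_of_reachable_iff π (splitGraph_reachable_iff U)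
  have hU : U.ncard + X.ncard = (X ∪ S ∪ T).ncard + (S ∩ T).ncard := by
    rw [ncard_splitVertices U]
    simp_rw [ncard_eq_sum_ite, ← Finset.sum_add_distrib]
    refine Finset.sum_congr rfl fun v _ => ?_
    have h1 := hST v
    have h2 : v ∈ (Sum.inl ⁻¹' U : Set V) ↔ v ∈ S := Iff.rfl
    have h3 : v ∈ {v | v ∉ X ∧ splitPort X (v, EdgeSign.minus) ∈ U} ↔ v ∉ X ∧ v ∈ T := Iff.rfl
    simp only [h2, h3, Set.mem_union, Set.mem_inter_iff]
    by_cases hX : v ∈ X <;> by_cases hvS : v ∈ S <;> by_cases hvT : v ∈ T <;> simp_all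
  have hfib : ∀ c : H.ConnectedComponent, (π ⁻¹' c.supp).ncard =
      (c.supp \ S).ncard + (c.supp \ (T ∪ X)).ncard := by
    intro c
    rw [← Set.ncard_image_of_injective _ Subtype.val_injective, ncard_splitVertices (X := X)]
    congr 1
    · congr 1
      ext v
      simp [π, hS, and_comm]
    · congr 1
      ext v
      simp only [Set.mem_image, Set.mem_preimage, Set.mem_ofPred_eq, Set.mem_sdiff, Set.mem_union,
        Subtype.exists, Set.mem_compl_iff, exists_and_right, exists_eq_right, hT, π, splitProj_port]
      tauto
  -- A component is either a singleton in `S ∩ T`, with no surviving copies, or it avoids `S ∩ T`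
  -- and has a number of surviving copies of the same parity as its number of vertices in `X ∪ S ∪ T`.
  have hc : ∀ c : H.ConnectedComponent, (if Odd (π ⁻¹' c.supp).ncard then 1 else 0) +
      2 * ((c.supp ∩ (X ∪ S ∪ T)).ncard / 2) + (c.supp ∩ (S ∩ T)).ncard ≤
        (c.supp ∩ (X ∪ S ∪ T)).ncard := by
    intro c
    rw [hfib]
    by_cases he : ∃ v ∈ c.supp, v ∈ S ∩ T
    · obtain ⟨v, hv, hvS, hvT⟩ := he
      rw [SimpleGraph.ConnectedComponent.mem_supp_iff] at hv
      subst hv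
      rw [separatedGraph_supp_eq_singleton hvS hvT]
      have h1 : {v} \ S = (∅ : Set V) :=
        Set.sdiff_eq_empty.2 (Set.singleton_subset_iff.2 hvS)
      have h2 : {v} \ (T ∪ X) = (∅ : Set V) :=
        Set.sdiff_eq_empty.2 (Set.singleton_subset_iff.2 (Or.inl hvT))
      have h3 : {v} ∩ (X ∪ S ∪ T) = ({v} : Set V) := by simp [hvS]
      have h4 : {v} ∩ (S ∩ T) = ({v} : Set V) := by simp [hvS, hvT]
      simp [h1, h2, h3, h4]
    · have h1 : c.supp ∩ (S ∩ T) = ∅ := by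
        ext v
        simp only [Set.mem_inter_iff, Set.mem_empty_iff_false, iff_false]
        exact fun hv => he ⟨v, hv⟩
      have h2 : (c.supp \ S).ncard + (c.supp \ (T ∪ X)).ncard + (c.supp ∩ (X ∪ S ∪ T)).ncard =
          c.supp.ncard + c.supp.ncard := by
        simp_rw [ncard_eq_sum_ite, ← Finset.sum_add_distrib]
        refine Finset.sum_congr rfl fun v _ => ?_
        have h1 := hST v
        by_cases hvc : v ∈ c.supp
        · have h3 : ¬ (v ∈ S ∧ v ∈ T) := fun hv => he ⟨v, hvc, hv⟩
          by_cases hX : v ∈ X <;> by_cases hvS : v ∈ S <;> by_cases hvT : v ∈ T <;> simp_all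
        · simp [hvc]
      rw [h1, Set.ncard_empty]
      split_ifs with hodd
      · obtain ⟨m, hm⟩ := hodd
        omega
      · omega
  have hsum := Finset.sum_le_sum fun c (_ : c ∈ Finset.univ) => hc c
  rw [Finset.sum_add_distrib, Finset.sum_add_distrib, ← Finset.mul_sum,
    ← finsum_eq_sum_of_fintype (fun c : H.ConnectedComponent => (c.supp ∩ (S ∩ T)).ncard),
    ← finsum_eq_sum_of_fintype (fun c : H.ConnectedComponent => (c.supp ∩ (X ∪ S ∪ T)).ncard),
    ← finsum_eq_sum_of_fintype (fun c : H.ConnectedComponent => (c.supp ∩ (X ∪ S ∪ T)).ncard / 2),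
    H.finsum_ncard_supp_inter, H.finsum_ncard_supp_inter] at hsum
  have hodd' : {c : H.ConnectedComponent | Odd (π ⁻¹' c.supp).ncard}.ncard =
      ∑ c : H.ConnectedComponent, if Odd (π ⁻¹' c.supp).ncard then 1 else 0 := by
    rw [ncard_eq_sum_ite]
    rfl
  omega

end Split

/-! ### Alternating paths in the split graph -/

section SplitWalk

variable {V : Type*} {X : Set V} {R : V × EdgeSign → V × EdgeSign → Prop}

/-- `IsSplitWalk X R L p` encodes an `X`-path with `L` edges in the split graph. For `i < L` an edge
leaves the copy `p i` of the `i`-th vertex and arrives at the mate of `p (i + 1)`. Since the mate of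
a copy is the copy of opposite sign, the two edges at an internal vertex have distinct signs. -/
structure IsSplitWalk (X : Set V) (R : V × EdgeSign → V × EdgeSign → Prop) (L : ℕ)
    (p : ℕ → V ⊕ ↥Xᶜ) : Prop where
  pos : 0 < L
  mem_iff : ∀ i ≤ L, splitProj X (p i) ∈ X ↔ i = 0 ∨ i = L
  injOn : ∀ i j, i < j → j ≤ L → splitProj X (p i) ≠ splitProj X (p j)
  rel : ∀ i < L, ∃ a b, R a b ∧ splitPort X a = p i ∧ splitPort X b = splitMate X (p (i + 1))

/-- A perfect matching of the split graph with `|X| - 2k` universal vertices added, combined with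
the matching of the copies of each vertex, decomposes into alternating paths, `k` of which are
disjoint `X`-paths: at most `|X| - 2k` vertices of `X` lie on paths ending in an added vertex. -/
lemma exists_splitWalks [Finite V] {hR : ∀ p q, R p q → R q p} {k d : ℕ}
    (hd : 2 * k + d = X.ncard) (f : (V ⊕ ↥Xᶜ) ⊕ Fin d → (V ⊕ ↥Xᶜ) ⊕ Fin d)
    (hf : f.Involutive) (hff : ∀ x, f x ≠ x)
    (hadj : ∀ a b, f (Sum.inl a) = Sum.inl b → (splitGraph X R hR).Adj a b) :
    ∃ (I : Finset ((V ⊕ ↥Xᶜ) ⊕ Fin d)) (L : (V ⊕ ↥Xᶜ) ⊕ Fin d → ℕ)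
      (p : (V ⊕ ↥Xᶜ) ⊕ Fin d → ℕ → V ⊕ ↥Xᶜ), k ≤ I.card ∧
      (∀ x ∈ I, IsSplitWalk X R (L x) (p x)) ∧
      ∀ x ∈ I, ∀ y ∈ I, x ≠ y → ∀ i ≤ L x, ∀ j ≤ L y,
        splitProj X (p x i) ≠ splitProj X (p y j) := by
  classical
  have := Fintype.ofFinite V
  have := Fintype.ofFinite ↥Xᶜ
  let g : ((V ⊕ ↥Xᶜ) ⊕ Fin d) → ((V ⊕ ↥Xᶜ) ⊕ Fin d) := Sum.map (splitMate X) id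
  have hg : g.Involutive := by
    rintro (a | i)
    · simp [g, splitMate_involutive a]
    · rfl
  have hex : ∀ x, ∃ L, g x = x → IsAltPath f g x L := by
    intro x
    by_cases hx : g x = x
    · obtain ⟨L, hL⟩ := exists_isAltPath hf hg hx
      exact ⟨L, fun _ => hL⟩
    · exact ⟨0, fun h => absurd h hx⟩
  choose L hL using hex
  let e : ((V ⊕ ↥Xᶜ) ⊕ Fin d) → ((V ⊕ ↥Xᶜ) ⊕ Fin d) := fun x => (g ∘ f)^[L x] x
  have he_fix : ∀ x, g x = x → g (e x) = e x := fun x hx => (hL x hx).2.1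
  have he_L : ∀ x, g x = x → L (e x) = L x := fun x hx =>
    (hL _ (he_fix x hx)).unique ((hL x hx).reverse hf hg hx).1
  have hee : ∀ x, g x = x → e (e x) = x := by
    intro x hx
    change (g ∘ f)^[L (e x)] (e x) = x
    rw [he_L x hx]
    have := ((hL x hx).reverse hf hg hx).2 (L x) le_rfl
    rw [Nat.sub_self, Function.iterate_zero_apply, hx] at this
    exact this
  have hne : ∀ x, g x = x → e x ≠ x := fun x hx h =>
    (hL x hx).iterate_ne hf hg hff hx (hL x hx).1 le_rfl h.symm
  -- `B` consists of the vertices of `X`, and `A` of those whose path ends in `X` again.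
  let B : Finset ((V ⊕ ↥Xᶜ) ⊕ Fin d) := Finset.univ.filter fun x => g x = x ∧ x.isLeft
  let A : Finset ((V ⊕ ↥Xᶜ) ⊕ Fin d) := B.filter fun x => (e x).isLeft
  have hB : X.ncard ≤ B.card := by
    rw [Set.ncard_eq_toFinset_card']
    refine Finset.card_le_card_of_injOn (fun v => Sum.inl (Sum.inl v)) ?_ ?_
    · intro v hv
      have hv' : v ∈ X := by simpa using hv
      simp [B, g, (splitMate_eq_self_iff (Sum.inl v : V ⊕ ↥Xᶜ)).2 hv']
    · intro v _ w _ h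
      exact Sum.inl_injective (Sum.inl_injective h)
  have hBA : (B.filter fun x => ¬ (e x).isLeft).card ≤ d := by
    have hcard : (Finset.univ.image (Sum.inr : Fin d → ((V ⊕ ↥Xᶜ) ⊕ Fin d))).card ≤ d :=
      Finset.card_image_le.trans (by simp)
    refine le_trans (Finset.card_le_card_of_injOn e ?_ ?_) hcard
    · intro x hx
      have hx' := (Finset.mem_filter.1 hx).2
      rcases hex : e x with a | i
      · simp [hex] at hx'
      · simp
    · intro x hx y hy hxy
      have hx' := (Finset.mem_filter.1 (Finset.mem_filter.1 hx).1).2.1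
      have hy' := (Finset.mem_filter.1 (Finset.mem_filter.1 hy).1).2.1
      rw [← hee x hx', ← hee y hy', hxy]
  have hA : 2 * k ≤ A.card := by
    have := Finset.card_filter_add_card_filter_not (s := B) (fun x => ((e x).isLeft : Prop))
    have hA' : A.card = (B.filter fun x => ((e x).isLeft : Prop)).card := rfl
    omega
  have hA_mem : ∀ x ∈ A, g x = x ∧ x.isLeft ∧ (e x).isLeft := by
    intro x hx
    have h1 := Finset.mem_filter.1 hx
    have h2 := Finset.mem_filter.1 h1.1
    exact ⟨h2.2.1, h2.2.2, h1.2⟩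
  obtain ⟨I, hIA, hAI, hI⟩ := exists_transversal_of_involution A e
    (fun x hx => by
      obtain ⟨h1, h2, h3⟩ := hA_mem x hx
      simp only [A, B, Finset.mem_filter, Finset.mem_univ, true_and]
      exact ⟨⟨he_fix x h1, h3⟩, by rwa [hee x h1]⟩)
    (fun x hx => hee x (hA_mem x hx).1) (fun x hx => hne x (hA_mem x hx).1)
  have hleft : ∀ x, ∃ p : ℕ → V ⊕ ↥Xᶜ, x ∈ A → ∀ i ≤ L x, (g ∘ f)^[i] x = Sum.inl (p i) := by
    intro x
    by_cases hx : x ∈ A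
    · obtain ⟨h1, h2, h3⟩ := hA_mem x hx
      have : ∀ i, ∃ w, i ≤ L x → (g ∘ f)^[i] x = Sum.inl w := by
        intro i
        rcases hw : (g ∘ f)^[i] x with w | j
        · exact ⟨w, fun _ => rfl⟩
        · obtain ⟨w, -⟩ := Sum.isLeft_iff.1 h2
          refine ⟨w, fun hi => ?_⟩
          -- The added vertices are fixed by `g`, so they can only occur at the ends.
          rcases (hL x h1).eq_zero_or_eq hi (by rw [hw]; rfl) with rfl | rfl
          · rw [Function.iterate_zero_apply] at hw
            simp [hw] at h2
          · change e x = _ at hw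
            simp [hw] at h3
      choose p hp using this
      exact ⟨p, fun _ => hp⟩
    · have : Nonempty (V ⊕ ↥Xᶜ) := by
        rcases x with w | i
        · exact ⟨w⟩
        · obtain ⟨v, -⟩ := X.nonempty_of_ncard_ne_zero (by have := i.pos; omega)
          exact ⟨Sum.inl v⟩
      exact ⟨fun _ => Classical.arbitrary _, fun h => absurd h hx⟩
  choose p hp using hleft
  refine ⟨I, L, p, by omega, fun x hx => ?_, fun x hx y hy hxy i hi j hj hij => ?_⟩
  · have hxA := hIA hx
    obtain ⟨h1, -, -⟩ := hA_mem x hxA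
    have hP := hL x h1
    have hp := hp x hxA
    have hinj : ∀ i j, i < j → j ≤ L x → splitProj X (p x i) ≠ splitProj X (p x j) := by
      intro i j hij hj h
      rcases eq_or_eq_splitMate h with h | h
      · refine hP.iterate_ne hf hg hff h1 hij hj ?_
        rw [hp i (by omega), hp j hj, h]
      · refine hP.ne_apply hf hg hff hij hj ?_
        rw [hp i (by omega), hp j hj, h]
        rfl
    have hfix : ∀ i ≤ L x, splitProj X (p x i) ∈ X ↔ g ((g ∘ f)^[i] x) = (g ∘ f)^[i] x := by
      intro i hi
      rw [hp i hi, ← splitMate_eq_self_iff]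
      exact Sum.inl_injective.eq_iff.symm
    refine ⟨hP.1, fun i hi => ?_, hinj, fun i hi => ?_⟩
    · rw [hfix i hi]
      refine ⟨fun h => hP.eq_zero_or_eq hi h, ?_⟩
      rintro (rfl | rfl)
      · exact h1
      · exact hP.2.1
    · have hfi : f (Sum.inl (p x i)) = Sum.inl (splitMate X (p x (i + 1))) := by
        have h2 := hp (i + 1) (by omega)
        rw [Function.iterate_succ_apply', hp i hi.le] at h2
        have h3 := congrArg g h2
        rw [Function.comp_apply, hg] at h3
        exact h3
      obtain ⟨-, h | ⟨a, b, hab, ha, hb⟩⟩ := hadj _ _ hfi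
      · rw [splitProj_mate] at h
        exact absurd h (hinj i (i + 1) (by omega) (by omega))
      · exact ⟨a, b, hab, ha, hb⟩
  · obtain ⟨hx1, -, -⟩ := hA_mem x (hIA hx)
    obtain ⟨hy1, -, -⟩ := hA_mem y (hIA hy)
    rcases (hL x hx1).eq_or_eq_of_meet hf hg hx1 hy1 (hL y hy1) hi hj (by
      rw [hp x (hIA hx) i hi, hp y (hIA hy) j hj]
      refine (eq_or_eq_splitMate hij).imp (congrArg _) fun h => ?_
      rw [h]
      rfl) with h | h
    · exact hxy h
    · exact hI x hx y hy h.symm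

end SplitWalk

/-! ### Components of multigraphs -/

namespace Graph

variable {α β : Type*} {G : Graph α β}

/-- The simple graph on the vertices of a multigraph in which distinct vertices are adjacent if
they are joined by an edge. -/
def underlyingSimpleGraph (G : Graph α β) : SimpleGraph ↥V(G) where
  Adj u v := u ≠ v ∧ G.Adj u v
  symm := ⟨fun _ _ h => ⟨h.1.symm, h.2.symm⟩⟩
  loopless := ⟨fun _ h => h.1 rfl⟩

lemma underlyingSimpleGraph_reachable_iff (u v : ↥V(G)) :
    G.underlyingSimpleGraph.Reachable u v ↔ Relation.ReflTransGen G.Adj u v := by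
  rw [SimpleGraph.reachable_iff_reflTransGen]
  constructor
  · intro h
    exact h.lift Subtype.val fun _ _ h => h.2
  · intro h
    have key : ∀ w, Relation.ReflTransGen G.Adj u w → ∀ hw : w ∈ V(G),
        Relation.ReflTransGen G.underlyingSimpleGraph.Adj u ⟨w, hw⟩ := by
      intro w hw
      induction hw with
      | refl => exact fun _ => .refl
      | tail _ h ih =>
        intro hw
        have h' := ih h.left_mem
        by_cases he : (⟨_, h.left_mem⟩ : ↥V(G)) = ⟨_, hw⟩
        · rwa [he] at h'
        · exact h'.tail ⟨he, h⟩
    exact key v h v.2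

/-- The submultigraph induced by a component of the underlying simple graph. -/
def componentGraph (G : Graph α β) (c : G.underlyingSimpleGraph.ConnectedComponent) : Graph α β :=
  G.induce (Subtype.val '' c.supp)

lemma componentGraph_le (c : G.underlyingSimpleGraph.ConnectedComponent) :
    G.componentGraph c ≤ G := by
  apply Graph.induce_le
  rintro _ ⟨v, -, rfl⟩
  exact v.2

lemma mem_componentGraph_mk (u : ↥V(G)) {w : α} (h : Relation.ReflTransGen G.Adj u w) :
    w ∈ V(G.componentGraph (G.underlyingSimpleGraph.connectedComponentMk u)) := by
  have hw : w ∈ V(G) := by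
    rcases h.cases_tail with h | ⟨_, _, h⟩
    · rw [h]
      exact u.2
    · exact h.right_mem
  refine ⟨⟨w, hw⟩, ?_, rfl⟩
  rw [SimpleGraph.ConnectedComponent.mem_supp_iff, SimpleGraph.ConnectedComponent.eq]
  exact ((underlyingSimpleGraph_reachable_iff u ⟨w, hw⟩).2 h).symm

lemma isConnected_componentGraph (c : G.underlyingSimpleGraph.ConnectedComponent) :
    (G.componentGraph c).IsConnected := by
  refine ⟨c.nonempty_supp.image _, ?_⟩
  rintro _ ⟨u, hu, rfl⟩ _ ⟨v, hv, rfl⟩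
  rw [SimpleGraph.ConnectedComponent.mem_supp_iff] at hu hv
  subst hu
  have huv := (underlyingSimpleGraph_reachable_iff u v).1
    (SimpleGraph.ConnectedComponent.eq.1 hv).symm
  generalize (v : α) = w at huv
  induction huv with
  | refl => exact .refl
  | tail hb h ih =>
    refine ih.tail ?_
    obtain ⟨e, he⟩ := h
    exact ⟨e, he, mem_componentGraph_mk u hb, mem_componentGraph_mk u (hb.tail ⟨e, he⟩)⟩

lemma IsConnected.le_componentGraph {H : Graph α β} (hH : H.IsConnected) (hHG : H ≤ G)
    {u : ↥V(G)} (hu : (u : α) ∈ V(H)) :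
    H ≤ G.componentGraph (G.underlyingSimpleGraph.connectedComponentMk u) := by
  have hmem : ∀ w ∈ V(H),
      w ∈ V(G.componentGraph (G.underlyingSimpleGraph.connectedComponentMk u)) :=
    fun w hw => mem_componentGraph_mk u ((hH.2 u hu w hw).lift id fun _ _ h => h.mono hHG)
  exact ⟨hmem, fun e x y h => ⟨h.mono hHG, hmem _ h.left_mem, hmem _ h.right_mem⟩⟩

lemma components_eq_range : G.components = Set.range G.componentGraph := by
  ext C
  constructor
  · rintro ⟨⟨hle, hconn⟩, hmax⟩
    obtain ⟨u, hu⟩ := hconn.1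
    have h := hconn.le_componentGraph hle (u := ⟨u, hle.vertexSet_mono hu⟩) hu
    exact ⟨_, le_antisymm (hmax ⟨componentGraph_le _, isConnected_componentGraph _⟩ h) h⟩
  · rintro ⟨c, rfl⟩
    refine ⟨⟨componentGraph_le c, isConnected_componentGraph c⟩, fun H ⟨hle, hconn⟩ h => ?_⟩
    obtain ⟨u, hu⟩ := c.nonempty_supp
    have hu' : (u : α) ∈ V(H) := h.vertexSet_mono ⟨u, hu, rfl⟩
    rw [SimpleGraph.ConnectedComponent.mem_supp_iff] at hu
    subst hu
    exact hconn.le_componentGraph hle hu'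

/-- A sum over the components of a multigraph of a function of their vertex sets can be taken over
the components of the underlying simple graph. -/
lemma finsum_components (G : Graph α β) (φ : Set α → ℕ) :
    ∑ᶠ C ∈ G.components, φ V(C) =
      ∑ᶠ c : G.underlyingSimpleGraph.ConnectedComponent, φ (Subtype.val '' c.supp) := by
  rw [components_eq_range, finsum_mem_range]
  · rfl
  · intro c c' h
    have : Subtype.val '' c.supp = Subtype.val '' c'.supp := congrArg Graph.vertexSet h
    exact SimpleGraph.ConnectedComponent.supp_injective
      (Set.image_injective.2 Subtype.val_injective this)

end Graph

/-! ### Counting disjoint sets against components -/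

/-- Disjoint vertex sets, each of which meets `Z` or contains two vertices of `Y` from the same
component of `H`: their number is at most `|Z| + ∑ ⌊|c ∩ Y| / 2⌋`. -/
lemma SimpleGraph.card_le_ncard_add_finsum {V ι : Type*} [Finite V] (H : SimpleGraph V)
    (Y Z : Set V) (F : Finset ι) (A : ι → Set V)
    (hdisj : ∀ P ∈ F, ∀ Q ∈ F, P ≠ Q → Disjoint (A P) (A Q))
    (h : ∀ P ∈ F, (∃ v ∈ A P, v ∈ Z) ∨
      ∃ a ∈ A P, ∃ b ∈ A P, a ≠ b ∧ a ∈ Y ∧ b ∈ Y ∧ H.Reachable a b) :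
    F.card ≤ Z.ncard + ∑ᶠ c : H.ConnectedComponent, (c.supp ∩ Y).ncard / 2 := by
  classical
  have := Fintype.ofFinite V
  have := Fintype.ofFinite H.ConnectedComponent
  have heq : ∀ P ∈ F, ∀ Q ∈ F, ∀ v, v ∈ A P → v ∈ A Q → P = Q := by
    intro P hP Q hQ v hvP hvQ
    by_contra hne
    exact Set.disjoint_left.1 (hdisj P hP Q hQ hne) hvP hvQ
  rw [finsum_eq_sum_of_fintype,
    ← Finset.card_filter_add_card_filter_not (s := F) (fun P => ∃ v ∈ A P, v ∈ Z)]
  refine add_le_add ?_ ?_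
  · rw [Set.ncard_eq_toFinset_card']
    rw [← Finset.card_attach]
    refine Finset.card_le_card_of_injOn
      (fun Q => (Finset.mem_filter.1 Q.2).2.choose) ?_ ?_
    · intro Q _
      simpa using (Finset.mem_filter.1 Q.2).2.choose_spec.2
    · intro P _ Q _ hPQ
      have h1 := (Finset.mem_filter.1 P.2).2.choose_spec.1
      have h2 := (Finset.mem_filter.1 Q.2).2.choose_spec.1
      dsimp only at hPQ
      rw [hPQ] at h1
      exact Subtype.ext (heq _ (Finset.mem_filter.1 P.2).1 _ (Finset.mem_filter.1 Q.2).1 _ h1 h2)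
  · have h' : ∀ P : {P // P ∈ F.filter fun P => ¬ ∃ v ∈ A P, v ∈ Z},
        ∃ p : Bool → V, Function.Injective p ∧ (∀ i, p i ∈ A P ∧ p i ∈ Y) ∧
          ∀ i, H.Reachable (p true) (p i) := by
      rintro ⟨P, hP⟩
      rw [Finset.mem_filter] at hP
      obtain ⟨a, ha, b, hb, hab, haY, hbY, hr⟩ := (h P hP.1).resolve_left hP.2
      refine ⟨fun i => if i then a else b, ?_, ?_, ?_⟩
      · rintro (_ | _) (_ | _) <;> simp [hab, hab.symm]
      · rintro (_ | _) <;> simp [*]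
      · rintro (_ | _) <;> simp [hr]
    choose p hpinj hpA hpr using h'
    rw [← Finset.card_attach, Finset.card_eq_sum_card_fiberwise
      (f := fun P => H.connectedComponentMk (p P true)) (t := Finset.univ) (by simp)]
    refine Finset.sum_le_sum fun c _ => ?_
    rw [Nat.le_div_iff_mul_le (by norm_num), Set.ncard_eq_toFinset_card',
      show 2 = (Finset.univ : Finset Bool).card from rfl, ← Finset.card_product]
    refine Finset.card_le_card_of_injOn (fun q => p q.1 q.2) ?_ ?_
    · rintro ⟨P, i⟩ hP
      have hc : H.connectedComponentMk (p P true) = c := by simpa using hP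
      simp only [Set.coe_toFinset, Set.mem_inter_iff, SimpleGraph.ConnectedComponent.mem_supp_iff]
      refine ⟨?_, (hpA P i).2⟩
      rw [← hc]
      exact SimpleGraph.ConnectedComponent.sound (hpr P i).symm
    · rintro ⟨P, i⟩ _ ⟨Q, j⟩ _ hPQ
      dsimp only at hPQ
      have h1 := (hpA P i).1
      rw [hPQ] at h1
      obtain rfl : P = Q := Subtype.ext (heq _ (Finset.mem_filter.1 P.2).1 _
        (Finset.mem_filter.1 Q.2).1 _ h1 (hpA Q j).1)
      rw [hpinj P hPQ]

/-! ### Paths in bidirected multigraphs -/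

namespace BidirectedMultigraph

variable {α β : Type*} {B : BidirectedMultigraph α β}

/-- Two signed vertices are related if some edge joins the two vertices and has these signs at
them. -/
def HalfLink (B : BidirectedMultigraph α β) (p q : ↥V(B.graph) × EdgeSign) : Prop :=
  ∃ (e : β) (h : B.graph.IsLink e p.1 q.1), B.sign p.1 e h.inc_left = p.2 ∧
    B.sign q.1 e h.inc_right = q.2

lemma HalfLink.symm (p q : ↥V(B.graph) × EdgeSign) : B.HalfLink p q → B.HalfLink q p :=
  fun ⟨e, h, h1, h2⟩ => ⟨e, h.symm, h2, h1⟩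

lemma underlyingSimpleGraph_separated (S T : Set ↥V(B.graph)) :
    (B.separated (Subtype.val '' S) (Subtype.val '' T)).underlyingSimpleGraph =
      separatedGraph B.HalfLink HalfLink.symm S T := by
  have hval : ∀ (v : ↥V(B.graph)) (s : EdgeSign),
      SurvivesSeparation (Subtype.val '' S) (Subtype.val '' T) ((v : α), s) ↔
        SurvivesSeparation S T (v, s) := by
    intro v s
    simp [SurvivesSeparation]
  refine SimpleGraph.ext (funext fun u => funext fun v => propext (and_congr Iff.rfl ?_))
  constructor
  · rintro ⟨e, he, hl⟩
    exact ⟨_, _, ⟨e, hl, rfl, rfl⟩, (hval _ _).1 (he _ hl.inc_left),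
      (hval _ _).1 (he _ hl.inc_right)⟩
  · rintro ⟨s, t, ⟨e, hl, hs', ht'⟩, hs, ht⟩
    replace hl : B.graph.IsLink e u v := hl
    have hs'' : B.sign u e hl.inc_left = s := hs'
    have ht'' : B.sign v e hl.inc_right = t := ht'
    subst hs'' ht''
    refine ⟨e, fun w hw => ?_, hl⟩
    obtain rfl | rfl := hw.eq_or_eq_of_isLink hl
    · exact (hval u _).2 hs
    · exact (hval v _).2 ht

lemma finsum_components_separated (X S T : Set ↥V(B.graph)) :
    ∑ᶠ C ∈ (B.separated (Subtype.val '' S) (Subtype.val '' T)).components,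
        (V(C) ∩ (Subtype.val '' X ∪ Subtype.val '' S ∪ Subtype.val '' T)).ncard / 2 =
      ∑ᶠ c : (separatedGraph B.HalfLink HalfLink.symm S T).ConnectedComponent,
        (c.supp ∩ (X ∪ S ∪ T)).ncard / 2 := by
  rw [Graph.finsum_components _ fun A =>
    (A ∩ (Subtype.val '' X ∪ Subtype.val '' S ∪ Subtype.val '' T)).ncard / 2]
  have key : ∀ (H : SimpleGraph ↥V(B.graph)),
      ∑ᶠ c : H.ConnectedComponent, ((Subtype.val '' c.supp : Set α) ∩
        (Subtype.val '' X ∪ Subtype.val '' S ∪ Subtype.val '' T)).ncard / 2 =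
      ∑ᶠ c : H.ConnectedComponent, (c.supp ∩ (X ∪ S ∪ T)).ncard / 2 := by
    intro H
    refine finsum_congr fun c => ?_
    rw [← Set.image_union, ← Set.image_union, ← Set.image_inter Subtype.val_injective,
      Set.ncard_image_of_injective _ Subtype.val_injective]
  rw [← underlyingSimpleGraph_separated]
  exact key _

/-- A walk in the split graph is an `X`-path of the bidirected multigraph. -/
lemma exists_path_of_isSplitWalk {X : Set ↥V(B.graph)} {L : ℕ} {p : ℕ → ↥V(B.graph) ⊕ ↥Xᶜ}
    (h : IsSplitWalk X B.HalfLink L p) :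
    ∃ P : B.Path, P.IsXPath (Subtype.val '' X) ∧
      ∀ a ∈ P.vertexSet, ∃ i ≤ L, a = splitProj X (p i) := by
  have hedge : ∀ i : Fin L, ∃ e, ∃ hl : B.graph.IsLink e (splitProj X (p i)).1
      (splitProj X (p (i + 1))).1,
      splitPort X (splitProj X (p i), B.sign _ e hl.inc_left) = p i ∧
      splitPort X (splitProj X (p (i + 1)), B.sign _ e hl.inc_right) =
        splitMate X (p (i + 1)) := by
    intro i
    obtain ⟨⟨a, s⟩, ⟨b, t⟩, ⟨e, hl, hs, ht⟩, ha, hb⟩ := h.rel i i.2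
    have ha' : a = splitProj X (p i) := by rw [← ha, splitProj_port]
    have hb' : b = splitProj X (p (i + 1)) := by
      rw [← splitProj_mate, ← hb, splitProj_port]
    subst ha' hb'
    have hl' : B.graph.IsLink e (splitProj X (p i)).1 (splitProj X (p (i + 1))).1 := hl
    have hs' : B.sign _ e hl'.inc_left = s := hs
    have ht' : B.sign _ e hl'.inc_right = t := ht
    subst hs' ht'
    exact ⟨e, hl', ha, hb⟩
  choose e hl hs ht using hedge
  have hinj : Function.Injective fun i : Fin (L + 1) => (splitProj X (p i)).1 := by
    intro i j hij
    have hij' := Subtype.ext hij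
    rcases lt_trichotomy i j with h1 | h1 | h1
    · exact absurd hij' (h.injOn i j h1 (by omega))
    · exact h1
    · exact absurd hij'.symm (h.injOn j i h1 (by omega))
  refine ⟨⟨L, fun i => (splitProj X (p i)).1, e, fun i => (splitProj X (p i)).2, hinj, ?_, ?_⟩,
    ⟨?_, ?_, ?_, ?_⟩, ?_⟩
  · exact fun i => hl i
  · intro i j v hiv hjv hi hj
    have hji : j.castSucc = i.succ := hinj (hjv.trans hiv.symm)
    have hji' : (j : ℕ) = i + 1 := congrArg Fin.val hji
    have hvX : splitProj X (p (i + 1)) ∉ X := by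
      rw [h.mem_iff _ (by omega)]
      omega
    refine sign_ne_of_splitPort_eq_mate hvX ?_
    have hs := hs j
    have ht := ht i
    subst hiv
    have h2 : splitPort X (splitProj X (p (i + 1)), B.sign _ (e j) hj) = p (i + 1) := by
      have hl := hl j
      have : ∀ (n : ℕ) (hn : n = i + 1) (h' : B.graph.Inc (e j) (splitProj X (p n)).1),
          splitPort X (splitProj X (p n), B.sign _ (e j) h') = p n →
          splitPort X (splitProj X (p (i + 1)), B.sign _ (e j) hj) = p (i + 1) := by
        rintro _ rfl _ h
        exact h
      exact this j hji' _ hs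
    rw [h2]
    exact ht
  · exact h.pos.ne'
  · exact ⟨_, (h.mem_iff 0 (Nat.zero_le _)).2 (Or.inl rfl), rfl⟩
  · exact ⟨_, (h.mem_iff L le_rfl).2 (Or.inr rfl), rfl⟩
  · rintro i hi0 hiL ⟨v, hv, hvi⟩
    have hvi' : v = splitProj X (p i) := Subtype.ext hvi
    subst hvi'
    rcases (h.mem_iff i (Nat.le_of_lt_succ i.2)).1 hv with h0 | h0
    · exact hi0 (Fin.ext h0)
    · exact hiL (Fin.ext h0)
  · rintro _ ⟨i, rfl⟩
    exact ⟨i, Nat.le_of_lt_succ i.2, rfl⟩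

lemma survivesSeparation_of_ne {V : Type*} {S T : Set V} {v : V} {s t : EdgeSign}
    (hv : v ∉ S ∩ T) (hst : s ≠ t) (hs : ¬ SurvivesSeparation S T (v, s)) :
    v ∈ S ∪ T ∧ SurvivesSeparation S T (v, t) := by
  have hv' : ¬ (v ∈ S ∧ v ∈ T) := hv
  cases s <;> cases t <;> simp_all [SurvivesSeparation]
  tauto

/-- An `X`-path avoiding `S ∩ T` has two vertices in `X ∪ S ∪ T` that lie in the same component of
`B_{S,T}`. Along the path, an edge dropped from `B_{S,T}` because of its sign at the vertex it
enters is followed by an edge whose sign there is admissible. -/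
lemma Path.IsXPath.exists_pair {P : B.Path} {X S T : Set α} (hP : P.IsXPath X)
    (hX : X ∩ S = X ∩ T) (hST : ∀ i, P.vertex i ∉ S ∩ T) :
    ∃ i j, i < j ∧ P.vertex i ∈ X ∪ S ∪ T ∧ P.vertex j ∈ X ∪ S ∪ T ∧
      Relation.ReflTransGen (B.separated S T).Adj (P.vertex i) (P.vertex j) := by
  obtain ⟨hlen, h0, hlast, -⟩ := hP
  have hX' : ∀ i s, P.vertex i ∈ X → SurvivesSeparation S T (P.vertex i, s) := by
    intro i s hi
    have h1 := Set.ext_iff.1 hX (P.vertex i)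
    have h2 := hST i
    simp only [Set.mem_inter_iff] at h1 h2
    refine Or.inl fun h => ?_
    rcases h with h | h <;> tauto
  by_contra! hno
  -- If the edge from `i` to `i + 1` is admissible where it leaves and where it arrives,
  -- then a vertex of `X ∪ S ∪ T` joined to the former is joined to the latter.
  have hstep : ∀ (i : Fin P.length) (j : Fin (P.length + 1)), j ≤ i.castSucc →
      P.vertex j ∈ X ∪ S ∪ T →
      Relation.ReflTransGen (B.separated S T).Adj (P.vertex j) (P.vertex i.castSucc) →
      SurvivesSeparation S T (P.vertex i.castSucc, B.sign _ _ (P.isLink i).inc_left) →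
      SurvivesSeparation S T (P.vertex i.succ, B.sign _ _ (P.isLink i).inc_right) →
      Relation.ReflTransGen (B.separated S T).Adj (P.vertex j) (P.vertex i.succ) ∧
        P.vertex i.succ ∉ X ∪ S ∪ T := by
    intro i j hji hj hr hs ht
    have hadj : (B.separated S T).Adj (P.vertex i.castSucc) (P.vertex i.succ) := by
      refine ⟨P.edge i, fun w hw => ?_, P.isLink i⟩
      obtain rfl | rfl := hw.eq_or_eq_of_isLink (P.isLink i)
      · exact hs
      · exact ht
    exact ⟨hr.tail hadj, fun h => hno j i.succ (lt_of_le_of_lt hji i.castSucc_lt_succ) hj h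
      (hr.tail hadj)⟩
  have hinv : ∀ n (hn : n < P.length), ∃ j : Fin (P.length + 1),
      j ≤ (⟨n, hn⟩ : Fin P.length).castSucc ∧ P.vertex j ∈ X ∪ S ∪ T ∧
      Relation.ReflTransGen (B.separated S T).Adj (P.vertex j)
        (P.vertex (⟨n, hn⟩ : Fin P.length).castSucc) ∧
      SurvivesSeparation S T (P.vertex (⟨n, hn⟩ : Fin P.length).castSucc,
        B.sign _ _ (P.isLink ⟨n, hn⟩).inc_left) := by
    intro n
    induction n with
    | zero => exact fun hn => ⟨0, le_rfl, Or.inl (Or.inl h0), .refl, hX' _ _ h0⟩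
    | succ n ih =>
      intro hn
      obtain ⟨j, hj, hjY, hr, hs⟩ := ih (by omega)
      have hne := P.sign_ne ⟨n, by omega⟩ ⟨n + 1, hn⟩ _ rfl rfl
        (P.isLink ⟨n, by omega⟩).inc_right (P.isLink ⟨n + 1, hn⟩).inc_left
      by_cases ht : SurvivesSeparation S T (P.vertex (⟨n, by omega⟩ : Fin P.length).succ,
          B.sign _ _ (P.isLink ⟨n, by omega⟩).inc_right)
      · obtain ⟨h1, h2⟩ := hstep _ j hj hjY hr hs ht
        exact ⟨j, hj.trans (Fin.le_def.2 (Nat.le_succ n)), hjY, h1,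
          Or.inl fun h => h2 (Set.union_assoc _ _ _ ▸ Or.inr h)⟩
      · obtain ⟨h1, h2⟩ := survivesSeparation_of_ne (hST _) hne ht
        exact ⟨_, le_rfl, Set.union_assoc _ _ _ ▸ Or.inr h1, .refl, h2⟩
  obtain ⟨j, hj, hjY, hr, hs⟩ := hinv (P.length - 1) (by omega)
  have hlast' : P.vertex (⟨P.length - 1, by omega⟩ : Fin P.length).succ ∈ X := by
    convert hlast using 2
    ext
    simp
    omega
  exact (hstep _ j hj hjY hr hs (hX' _ _ hlast')).2 (Or.inl (Or.inl hlast'))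

end BidirectedMultigraph

/-! ### The min-max theorem -/

theorem theorem3p1 {α β : Type*} (B : BidirectedMultigraph α β)
    (hV : V(B.graph).Finite) (X : Set α) (hX : X ⊆ V(B.graph)) (k : ℕ) :
    B.HasDisjointXPaths X k ↔
      ∀ S T : Set α, S ⊆ V(B.graph) → T ⊆ V(B.graph) → X ∩ S = X ∩ T →
        k ≤ (S ∩ T).ncard +
          ∑ᶠ C ∈ (B.separated S T).components, (V(C) ∩ (X ∪ S ∪ T)).ncard / 2 := by
  classical
  have := hV.to_subtype
  have hlift : ∀ A ⊆ V(B.graph), ∃ A' : Set ↥V(B.graph), Subtype.val '' A' = A :=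
    fun A hA => ⟨Subtype.val ⁻¹' A, Set.image_preimage_eq_of_subset (by simpa using hA)⟩
  have hinter : ∀ A A' : Set ↥V(B.graph), Subtype.val '' A ∩ Subtype.val '' A' =
      (Subtype.val '' (A ∩ A') : Set α) := fun _ _ => (Set.image_inter Subtype.val_injective).symm
  obtain ⟨X, rfl⟩ := hlift X hX
  constructor
  · rintro ⟨F, rfl, hF, hdisj⟩ S T hS hT hST
    obtain ⟨S, rfl⟩ := hlift S hS
    obtain ⟨T, rfl⟩ := hlift T hT
    rw [BidirectedMultigraph.finsum_components_separated, hinter,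
      Set.ncard_image_of_injective _ Subtype.val_injective]
    refine SimpleGraph.card_le_ncard_add_finsum _ _ _ F (fun P => Subtype.val ⁻¹' P.vertexSet)
      (fun P hP Q hQ hPQ => (hdisj P hP Q hQ hPQ).preimage _) fun P hP => ?_
    by_cases hmeet : ∃ i, P.vertex i ∈ (Subtype.val '' S : Set α) ∩ Subtype.val '' T
    · obtain ⟨i, hi⟩ := hmeet
      rw [hinter] at hi
      obtain ⟨v, hv, hvi⟩ := hi
      exact Or.inl ⟨v, ⟨i, hvi.symm⟩, hv⟩
    · obtain ⟨i, j, hij, hi, hj, hr⟩ := (hF P hP).exists_pair hST (not_exists.1 hmeet)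
      refine Or.inr ⟨⟨P.vertex i, P.vertex_mem i⟩, ⟨i, rfl⟩, ⟨P.vertex j, P.vertex_mem j⟩, ⟨j, rfl⟩,
        fun h => hij.ne (P.vertex_injective (congrArg Subtype.val h)), ?_, ?_, ?_⟩
      · simpa [P.vertex_mem i] using hi
      · simpa [P.vertex_mem j] using hj
      · rw [← BidirectedMultigraph.underlyingSimpleGraph_separated]
        exact (Graph.underlyingSimpleGraph_reachable_iff
          (G := B.separated (Subtype.val '' S) (Subtype.val '' T))
          ⟨P.vertex i, P.vertex_mem i⟩ ⟨P.vertex j, P.vertex_mem j⟩).2 hr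
  · intro h
    have h' : ∀ S T : Set ↥V(B.graph), X ∩ S = X ∩ T → k ≤ (S ∩ T).ncard +
        ∑ᶠ c : (separatedGraph B.HalfLink BidirectedMultigraph.HalfLink.symm S T).ConnectedComponent,
          (c.supp ∩ (X ∪ S ∪ T)).ncard / 2 := by
      intro S T hST
      have := h (Subtype.val '' S) (Subtype.val '' T) (by simp) (by simp)
        (by rw [hinter, hinter, hST])
      rwa [BidirectedMultigraph.finsum_components_separated, hinter,
        Set.ncard_image_of_injective _ Subtype.val_injective] at this
    have hodd := splitGraph_oddComponents_le h'
    -- The case `U = ∅`, which corresponds to `S = T = ∅`, gives `2k ≤ |X|`.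
    obtain ⟨d, hd⟩ : ∃ d, 2 * k + d = X.ncard := by
      have := hodd ∅
      rw [Set.ncard_empty] at this
      exact Nat.exists_eq_add_of_le (by omega) |>.imp fun _ h => h.symm
    have hcard : Nat.card (↥V(B.graph) ⊕ ↥Xᶜ) + X.ncard = 2 * Nat.card ↥V(B.graph) := by
      have := Set.ncard_add_ncard_compl X
      rw [Nat.card_sum, Nat.card_coe_set_eq Xᶜ]
      omega
    obtain ⟨f, hf, hff, hadj⟩ := SimpleGraph.exists_involutive_of_oddComponents_le
      (splitGraph X B.HalfLink BidirectedMultigraph.HalfLink.symm) d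
      (by rw [Nat.even_iff]; omega) (fun u => by have := hodd u; omega)
    obtain ⟨I, L, p, hI, hwalk, hdisj⟩ := exists_splitWalks hd f hf hff hadj
    obtain ⟨I, hII, rfl⟩ := Finset.exists_subset_card_eq hI
    choose P hP hPv using fun x : I =>
      BidirectedMultigraph.exists_path_of_isSplitWalk (hwalk x (hII x.2))
    have hPdisj : ∀ x y, x ≠ y → Disjoint (P x).vertexSet (P y).vertexSet := by
      intro x y hxy
      rw [Set.disjoint_left]
      intro a hax hay
      obtain ⟨i, hi, hai⟩ := hPv x a hax
      obtain ⟨j, hj, haj⟩ := hPv y a hay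
      exact hdisj x (hII x.2) y (hII y.2) (fun h => hxy (Subtype.ext h)) i hi j hj
        (Subtype.ext (hai.symm.trans haj))
    have hPinj : Function.Injective P := by
      intro x y hxy
      by_contra hne
      have := hPdisj x y hne
      rw [hxy] at this
      exact Set.disjoint_left.1 this ⟨0, rfl⟩ ⟨0, rfl⟩
    refine ⟨Finset.univ.image P, ?_, ?_, ?_⟩
    · rw [Finset.card_image_of_injective _ hPinj]
      simp
    · intro Q hQ
      obtain ⟨x, -, rfl⟩ := Finset.mem_image.1 hQ
      exact hP x
    · intro Q hQ Q' hQ' hne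
      obtain ⟨x, -, rfl⟩ := Finset.mem_image.1 hQ
      obtain ⟨y, -, rfl⟩ := Finset.mem_image.1 hQ'
      exact hPdisj x y fun h => hne (by rw [h])
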